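/- For $n\ge 2$ let $\mathrm{Cyl}_n=C_n\times P_n$ be the cylinder graph, with $C_n=(\frac1n\mathbb Z)/\mathbb Z$ the cycle, $P_n=(\frac1n\mathbb Z)\cap[0,1]$ the path, and a self-loop added at each vertex of $C_n\times\{0\}$ and $C_n\times\{1\}$, so that the graph is $4$-regular and has $n(n+1)$ vertices. Fix $\alpha\in(0,1)$. A configuration $\sigma\in\Omega$ is a colouring of the vertices of $\mathrm{Cyl}_n$ blue or red with exactly $\lfloor\alpha n(n+1)\rfloor$ blue vertices. One step $\sigma_0\to\sigma_1$ of competitive erosion is as follows. A simple random walk $X$ started uniformly on $C_n\times\{0\}$ runs until it first visits a red vertex of $\sigma_0$, and this vertex is recoloured blue, which gives $\sigma_{1/2}$. Then an independent simple random walk $Y$ started uniformly on $C_n\times\{1\}$ runs until it first visits a blue vertex of $\sigma_{1/2}$, and this vertex is recoloured red, which gives $\sigma_1$. (Both walks include their starting points among the visited vertices.) Let $$h(\sigma)=\sum_{(x,y)\text{ blue in }\sigma}(1-y).$$ For $\varepsilon>0$ let $\Omega_\varepsilon$ be the set of $\sigma\in\Omega$ such that at most $\varepsilon n$ rows $C_n\times\{y\}$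 with $y\le\alpha$ contain a red vertex and at most $\varepsilon n$ rows $C_n\times\{y\}$ with $y\ge\alpha$ contain a blue vertex. Theorem. For every $\varepsilon>0$ there is $a=a(\varepsilon)>0$ such that for every $\alpha\in(0,1)$, for all sufficiently large $n$ (depending on $\varepsilon$ and $\alpha$) and all $\sigma\in\Omega\setminus\Omega_\varepsilon$, $$\mathbb E\bigl(h(\sigma_1)-h(\sigma_0)\mid\sigma_0=\sigma\bigr)\ge a.$$ -/

import Mathlib

open MeasureTheory ProbabilityTheory

namespace CompetitiveErosion

/-- The vertices of the cylinder graph `C_n × P_n`. The pair `(x, j)` stands for the point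
`(x / n, j / n)` of `(ℝ / ℤ) × [0, 1]`, so there are `n + 1` rows of `n` vertices each. -/
@[ext]
structure Cyl (n : ℕ) where
  /-- the position around the cycle -/
  x : ZMod n
  /-- the index of the row -/
  row : Fin (n + 1)
  deriving DecidableEq

/-- A vertex is a pair consisting of its position on the cycle and its row. -/
def Cyl.equivProd (n : ℕ) : Cyl n ≃ ZMod n × Fin (n + 1) where
  toFun v := (v.x, v.row)
  invFun p := ⟨p.1, p.2⟩
  left_inv _ := rfl
  right_inv _ := rfl

noncomputable instance (n : ℕ) [NeZero n] : Fintype (Cyl n) :=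
  Fintype.ofEquiv _ (Cyl.equivProd n).symm

/-- The discrete σ-algebra on the vertices. -/
instance (n : ℕ) : MeasurableSpace (Cyl n) := ⊤

variable {n : ℕ}

/-- The second coordinate `y = j / n` of a vertex. -/
noncomputable def Cyl.y (v : Cyl n) : ℝ := (v.row : ℕ) / (n : ℝ)

/-- The other ends of the four edges at a vertex: the two horizontal neighbours on the cycle, and
the vertical neighbours above and below. At the top row the edge upwards, and at the bottom row
the edge downwards, is replaced by a self-loop. -/
def Cyl.nbr (v : Cyl n) : Fin 4 → Cyl n :=
  ![⟨v.x + 1, v.row⟩,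
    ⟨v.x - 1, v.row⟩,
    ⟨v.x, ⟨min ((v.row : ℕ) + 1) n, by omega⟩⟩,
    ⟨v.x, ⟨(v.row : ℕ) - 1, by omega⟩⟩]

/-- The transition probabilities of simple random walk on the (4-regular) cylinder graph. -/
noncomputable def stepProb (v w : Cyl n) : ℝ :=
  (Finset.univ.filter fun d : Fin 4 => v.nbr d = w).card / 4

/-- The uniform distribution on the bottom row `y = 0`. -/
noncomputable def bottomLaw (v : Cyl n) : ℝ := if v.row = 0 then 1 / n else 0

/-- The uniform distribution on the top row `y = 1`. -/
noncomputable def topLaw (v : Cyl n) : ℝ := if v.row = Fin.last n then 1 / n else 0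

/-- `X` is a simple random walk on the cylinder graph with initial distribution `init`, under the
probability measure `P`. -/
structure IsSimpleRandomWalk {Ω : Type*} [MeasurableSpace Ω] (P : Measure Ω)
    (init : Cyl n → ℝ) (X : ℕ → Ω → Cyl n) : Prop where
  measurable : ∀ s, Measurable (X s)
  law : ∀ (s : ℕ) (v : ℕ → Cyl n),
    P.real {ω | ∀ i ≤ s, X i ω = v i} =
      init (v 0) * ∏ i ∈ Finset.range s, stepProb (v i) (v (i + 1))

/-- The first vertex of `A` that the trajectory `X` visits. (If it never visits `A`, which has
probability zero in all uses below, this is the starting vertex.) -/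
noncomputable def firstVisit (X : ℕ → Cyl n) (A : Set (Cyl n)) : Cyl n :=
  X (sInf {s | X s ∈ A})

/-- The state after the first half step. A configuration is given by its set `S` of blue
vertices, all other vertices being red. The first red vertex that the blue walker `X` visits
becomes blue. -/
noncomputable def halfStep (S : Finset (Cyl n)) (X : ℕ → Cyl n) : Finset (Cyl n) :=
  insert (firstVisit X {v | v ∉ S}) S

/-- One full step of competitive erosion: after the half step of the blue walker `X`, the first
blue vertex that the red walker `Y` visits becomes red. -/
noncomputable def fullStep (S : Finset (Cyl n)) (X Y : ℕ → Cyl n) : Finset (Cyl n) :=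
  (halfStep S X).erase (firstVisit Y {v | v ∈ halfStep S X})

/-- The height function `h(σ) = ∑_{(x, y) blue} (1 - y)`. -/
noncomputable def height (S : Finset (Cyl n)) : ℝ := ∑ v ∈ S, (1 - v.y)

/-- The state space `Ω`: configurations with exactly `⌊α |Cyl_n|⌋` blue vertices. -/
def stateSpace (n : ℕ) [NeZero n] (α : ℝ) : Set (Finset (Cyl n)) :=
  {S | S.card = ⌊α * Fintype.card (Cyl n)⌋₊}

/-- The rows with `y ≤ α` that contain a red vertex. -/
def lowRedRows (α : ℝ) (S : Finset (Cyl n)) : Set (Fin (n + 1)) :=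
  {j | ∃ v : Cyl n, v.row = j ∧ v.y ≤ α ∧ v ∉ S}

/-- The rows with `y ≥ α` that contain a blue vertex. -/
def highBlueRows (α : ℝ) (S : Finset (Cyl n)) : Set (Fin (n + 1)) :=
  {j | ∃ v : Cyl n, v.row = j ∧ α ≤ v.y ∧ v ∈ S}

/-- The set `Ω_ε` of configurations with few bad rows. -/
def goodStates (n : ℕ) [NeZero n] (α ε : ℝ) : Set (Finset (Cyl n)) :=
  {S ∈ stateSpace n α |
    ((lowRedRows α S).ncard : ℝ) ≤ ε * n ∧ ((highBlueRows α S).ncard : ℝ) ≤ ε * n}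

end CompetitiveErosion

open CompetitiveErosion

/-!
The height change in one step is `y(W) - y(Z)`, where `Z` is the vertex at which the blue walker
stops and `W` the one at which the red walker stops. Let `S` be the blue set, `B` the set `S`
together with `Z`, and measure heights by the row index. Let `u` be the harmonic extension of the
row index from the complement of `S` into `S`, and `w` its harmonic extension from `B` into the
complement of `B`. By optional stopping, `u` averaged over the bottom row is the mean row of `Z`,
and `w` averaged over the top row is the mean row of `W` given `Z`. So the expected drift is the
average over `Z` of `1 - D / n ^ 2`, where `D = ∑ f (bottom) + ∑ g (top)` with `f = (u - row)⁺` and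
`g = (row - w)⁺` (`le_integral_height_sub`), and it remains to bound `D` away from `n ^ 2`,
uniformly in `Z`.

The functions `f` and `g` have disjoint supports, `f` vanishes on the top row and `g` on the bottom
row, and summation by parts gives `energy f + energy g ≤ D` (`isPotentialPair_of_harmonic`). On the
other hand, follow `f` in a column from the bottom up to its first zero, and `g` from there to the
top. Together these paths use at most `n + 1` edges, and `2 d ≤ d ^ 2 + 1` for each increment, so
`2 D ≤ vertical energy + n (n + 1)`. Hence `D + horizontal energy ≤ n (n + 1)`
(`IsPotentialPair.sum_rowEnergy_le`).

If `D` is close to `n ^ 2`, the horizontal energy is therefore small, and all but a few rows carry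
little of it. In such a row `f` is uniformly small as soon as the row contains a red vertex, and `g`
as soon as it contains a blue one, by Cauchy–Schwarz around the cycle. If a row of the second kind
lay far above one of the first kind, the vertical edges between them could be skipped in the bound
for `D`, and `D` would be too small (`IsPotentialPair.row_sub_row_le`). So, up to a small fraction
of the rows, the configuration is blue below some row and red above it, and the number of blue
vertices forces this row to be near height `α`: the configuration lies in `goodStates`
(`IsPotentialPair.mem_goodStates`).
-/

namespace CompetitiveErosion
variable {n : ℕ}

/-! ### The Laplacian and the Dirichlet form on the cylinder -/

/-- The vertex in column `x` and row `j`, the row index being a natural number. Indices above `n`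
stand for the top row. -/
def Cyl.at (x : ZMod n) (j : ℕ) : Cyl n := ⟨x, ⟨min j n, by omega⟩⟩

lemma Cyl.at_row (v : Cyl n) : Cyl.at v.x v.row = v := by
  ext
  · rfl
  · simp [Cyl.at]; omega

lemma Cyl.row_at (x : ZMod n) {j : ℕ} (hj : j ≤ n) : ((Cyl.at x j).row : ℕ) = j := by
  simp [Cyl.at, hj]

/-- The graph Laplacian, without normalisation by the degree. -/
noncomputable def lap (u : Cyl n → ℝ) (v : Cyl n) : ℝ := ∑ d, (u v - u (v.nbr d))

lemma lap_add (u w : Cyl n → ℝ) (v : Cyl n) : lap (u + w) v = lap u v + lap w v := by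
  simp only [lap, Pi.add_apply, ← Finset.sum_add_distrib]
  exact Finset.sum_congr rfl fun _ _ => by ring

lemma lap_smul (c : ℝ) (u : Cyl n → ℝ) (v : Cyl n) : lap (c • u) v = c * lap u v := by
  simp only [lap, Pi.smul_apply, smul_eq_mul, Finset.mul_sum]
  exact Finset.sum_congr rfl fun _ _ => by ring

lemma lap_sub (u w : Cyl n → ℝ) (v : Cyl n) : lap (u - w) v = lap u v - lap w v := by
  simp only [lap, Pi.sub_apply, ← Finset.sum_sub_distrib]
  exact Finset.sum_congr rfl fun _ _ => by ring

lemma lap_sub_const (u : Cyl n → ℝ) (c : ℝ) (v : Cyl n) : lap (fun w => u w - c) v = lap u v := by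
  simp [lap]

lemma lap_const_sub (u : Cyl n → ℝ) (c : ℝ) (v : Cyl n) :
    lap (fun w => c - u w) v = - lap u v := by
  simp only [lap, ← Finset.sum_neg_distrib]
  exact Finset.sum_congr rfl fun _ _ => by ring

/-- The part of the Dirichlet form that comes from the vertical edges of column `x`. -/
noncomputable def colForm (f h : Cyl n → ℝ) (x : ZMod n) : ℝ :=
  ∑ j ∈ Finset.range n,
    (f (Cyl.at x (j + 1)) - f (Cyl.at x j)) * (h (Cyl.at x (j + 1)) - h (Cyl.at x j))

lemma colForm_self_nonneg (f : Cyl n → ℝ) (x : ZMod n) : 0 ≤ colForm f f x :=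
  Finset.sum_nonneg fun _ _ => mul_self_nonneg _

section
variable [NeZero n]

/-- The part of the Dirichlet form that comes from the horizontal edges of row `j`. -/
noncomputable def rowForm (f h : Cyl n → ℝ) (j : ℕ) : ℝ :=
  ∑ x : ZMod n, (f (Cyl.at (x + 1) j) - f (Cyl.at x j)) * (h (Cyl.at (x + 1) j) - h (Cyl.at x j))

/-- The Dirichlet form: the sum over all edges (the self-loops contribute nothing) of the product
of the increments. -/
noncomputable def dirichlet (f h : Cyl n → ℝ) : ℝ :=
  ∑ j ∈ Finset.range (n + 1), rowForm f h j + ∑ x, colForm f h x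

lemma sum_cyl (F : Cyl n → ℝ) :
    ∑ v, F v = ∑ x : ZMod n, ∑ j ∈ Finset.range (n + 1), F (Cyl.at x j) := by
  have : ∑ v, F v = ∑ p : ZMod n × Fin (n + 1), F ⟨p.1, p.2⟩ :=
    Fintype.sum_equiv (Cyl.equivProd n) _ _ fun _ => rfl
  rw [this, Fintype.sum_prod_type]
  refine Finset.sum_congr rfl fun x _ => ?_
  rw [← Fin.sum_univ_eq_sum_range (fun j => F (Cyl.at x j))]
  refine Finset.sum_congr rfl fun j _ => ?_
  rw [← Cyl.at_row ⟨x, j⟩]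

lemma sum_mul_lap (f h : Cyl n → ℝ) : ∑ v, f v * lap h v = dirichlet f h := by
  have hlap (x : ZMod n) (j : ℕ) (hj : j ≤ n) : lap h (Cyl.at x j) =
      ((h (Cyl.at x j) - h (Cyl.at (x + 1) j)) + (h (Cyl.at x j) - h (Cyl.at (x - 1) j))) +
      ((h (Cyl.at x j) - h (Cyl.at x (min (j + 1) n))) +
        (h (Cyl.at x j) - h (Cyl.at x (j - 1)))) := by
    have hj' : min (j - 1) n = j - 1 := by omega
    simp [lap, Fin.sum_univ_four, Cyl.nbr, Cyl.at, hj, hj']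
    ring
  have hrow (j : ℕ) : ∑ x : ZMod n, f (Cyl.at x j) * ((h (Cyl.at x j) - h (Cyl.at (x + 1) j)) +
      (h (Cyl.at x j) - h (Cyl.at (x - 1) j))) = rowForm f h j := by
    have key : ∑ x : ZMod n, f (Cyl.at x j) * (h (Cyl.at x j) - h (Cyl.at (x - 1) j)) =
        ∑ x : ZMod n, f (Cyl.at (x + 1) j) * (h (Cyl.at (x + 1) j) - h (Cyl.at x j)) :=
      (Fintype.sum_equiv (Equiv.addRight (1 : ZMod n)) _ _ fun x => by simp).symm
    simp only [mul_add, Finset.sum_add_distrib, key, rowForm]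
    rw [← Finset.sum_add_distrib]
    exact Finset.sum_congr rfl fun _ _ => by ring
  have hcol (x : ZMod n) : ∑ j ∈ Finset.range (n + 1), f (Cyl.at x j) *
      ((h (Cyl.at x j) - h (Cyl.at x (min (j + 1) n))) +
        (h (Cyl.at x j) - h (Cyl.at x (j - 1)))) = colForm f h x := by
    simp only [mul_add, Finset.sum_add_distrib]
    rw [Finset.sum_range_succ, Finset.sum_range_succ']
    simp only [add_tsub_cancel_right, zero_tsub, sub_self, mul_zero, add_zero, colForm,
      min_eq_right (Nat.le_succ n)]
    rw [← Finset.sum_add_distrib]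
    refine Finset.sum_congr rfl fun j hj => ?_
    rw [min_eq_left (by simpa using hj)]
    ring
  rw [sum_cyl, dirichlet]
  simp_rw [← hrow, ← hcol]
  rw [Finset.sum_comm (s := Finset.range (n + 1)), ← Finset.sum_add_distrib]
  refine Finset.sum_congr rfl fun x _ => ?_
  rw [← Finset.sum_add_distrib]
  refine Finset.sum_congr rfl fun j hj => ?_
  rw [hlap x j (by simpa [Nat.lt_succ_iff] using hj), mul_add]

lemma rowForm_self_nonneg (f : Cyl n → ℝ) (j : ℕ) : 0 ≤ rowForm f f j :=
  Finset.sum_nonneg fun _ _ => mul_self_nonneg _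

/-- Contraction property of the Dirichlet form under taking the positive part. -/
lemma dirichlet_pos_le (h : Cyl n → ℝ) :
    dirichlet (fun v => max (h v) 0) (fun v => max (h v) 0) ≤
      dirichlet (fun v => max (h v) 0) h := by
  have key (a b : ℝ) : (max a 0 - max b 0) * (max a 0 - max b 0) ≤
      (max a 0 - max b 0) * (a - b) := by
    rcases le_total a 0 with ha | ha <;> rcases le_total b 0 with hb | hb <;>
      simp only [max_eq_left, max_eq_right, ha, hb] <;> nlinarith
  exact add_le_add (Finset.sum_le_sum fun _ _ => Finset.sum_le_sum fun _ _ => key _ _)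
    (Finset.sum_le_sum fun _ _ => Finset.sum_le_sum fun _ _ => key _ _)

lemma sum_range_cycle_le (F : ZMod n → ℝ) (hF : ∀ x, 0 ≤ F x) (x₀ : ZMod n) {k : ℕ} (hk : k ≤ n) :
    ∑ i ∈ Finset.range k, F (x₀ + i) ≤ ∑ x, F x := by
  have hinj : Set.InjOn (fun i : ℕ => x₀ + (i : ZMod n)) (Finset.range k) := by
    intro i hi j hj hij
    simp only [Finset.coe_range, Set.mem_Iio] at hi hj
    have := add_left_cancel hij
    rw [ZMod.natCast_eq_natCast_iff'] at this
    rwa [Nat.mod_eq_of_lt (by omega), Nat.mod_eq_of_lt (by omega)] at this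
  rw [← Finset.sum_image (f := F) hinj]
  exact Finset.sum_le_sum_of_subset_of_nonneg (Finset.subset_univ _) fun x _ _ => hF x

/-- Cauchy–Schwarz around a row: a function that vanishes somewhere on a row is controlled there
by the energy of the row. -/
lemma sq_le_rowForm (f : Cyl n → ℝ) (j : ℕ) (x₀ x : ZMod n) (h0 : f (Cyl.at x₀ j) = 0) :
    f (Cyl.at x j) ^ 2 ≤ n * rowForm f f j := by
  obtain ⟨k, hk, rfl⟩ : ∃ k : ℕ, k < n ∧ x = x₀ + k :=
    ⟨(x - x₀).val, ZMod.val_lt _, by simp⟩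
  have htel : f (Cyl.at (x₀ + k) j) =
      ∑ i ∈ Finset.range k, (f (Cyl.at (x₀ + i + 1) j) - f (Cyl.at (x₀ + i) j)) := by
    have := Finset.sum_range_sub (fun i : ℕ => f (Cyl.at (x₀ + i) j)) k
    simp only [Nat.cast_add, Nat.cast_one, Nat.cast_zero, add_zero, h0, sub_zero,
      ← add_assoc] at this
    exact this.symm
  rw [htel]
  have hcs := sq_sum_le_card_mul_sum_sq (s := Finset.range k)
    (f := fun i : ℕ => f (Cyl.at (x₀ + i + 1) j) - f (Cyl.at (x₀ + i) j))
  have hle := sum_range_cycle_le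
    (fun x => (f (Cyl.at (x + 1) j) - f (Cyl.at x j)) ^ 2) (fun _ => sq_nonneg _) x₀ hk.le
  have hform : ∑ x, (f (Cyl.at (x + 1) j) - f (Cyl.at x j)) ^ 2 = rowForm f f j := by
    simp only [rowForm, sq]
  rw [Finset.card_range] at hcs
  rw [hform] at hle
  have hkn : (k : ℝ) ≤ n := by exact_mod_cast hk.le
  calc _ ≤ _ := hcs
    _ ≤ k * rowForm f f j := by gcongr
    _ ≤ _ := mul_le_mul_of_nonneg_right hkn (rowForm_self_nonneg f j)

lemma eq_zero_of_dirichlet_nonpos (f : Cyl n → ℝ) (hf : dirichlet f f ≤ 0) (v₀ : Cyl n)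
    (h0 : f v₀ = 0) (v : Cyl n) : f v = 0 := by
  have hr : 0 ≤ ∑ j ∈ Finset.range (n + 1), rowForm f f j :=
    Finset.sum_nonneg fun j _ => rowForm_self_nonneg f j
  have hc : 0 ≤ ∑ x, colForm f f x := Finset.sum_nonneg fun j _ => colForm_self_nonneg f j
  unfold dirichlet at hf
  have hr0 (j : ℕ) (hj : j ≤ n) : rowForm f f j = 0 :=
    (Finset.sum_eq_zero_iff_of_nonneg fun j _ => rowForm_self_nonneg f j).1
      (by linarith : ∑ j ∈ Finset.range (n + 1), rowForm f f j = 0) j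
      (by simpa [Nat.lt_succ_iff] using hj)
  have hc0 (x : ZMod n) : colForm f f x = 0 :=
    (Finset.sum_eq_zero_iff_of_nonneg fun x _ => colForm_self_nonneg f x).1
      (by linarith : ∑ x, colForm f f x = 0) x (Finset.mem_univ x)
  have hstep (x : ZMod n) (j : ℕ) (hj : j < n) : f (Cyl.at x (j + 1)) = f (Cyl.at x j) := by
    have := (Finset.sum_eq_zero_iff_of_nonneg fun j _ => mul_self_nonneg _).1 (hc0 x) j
      (by simpa using hj)
    linarith [mul_self_eq_zero.1 this]
  have hcol (x : ZMod n) (j : ℕ) (hj : j ≤ n) : f (Cyl.at x j) = f (Cyl.at x 0) := by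
    induction j with
    | zero => rfl
    | succ j ih => rw [hstep x j (by omega), ih (by omega)]
  rw [← Cyl.at_row v₀, hcol _ _ (by omega)] at h0
  rw [← Cyl.at_row v, hcol _ _ (by omega)]
  have := sq_le_rowForm f 0 v₀.x v.x h0
  rw [hr0 0 (by omega), mul_zero] at this
  exact pow_eq_zero_iff (two_ne_zero) |>.1 (le_antisymm this (sq_nonneg _))

/-- The maximum principle. -/
lemma nonpos_of_lap_nonpos (A : Set (Cyl n)) (hA : ∃ v, v ∉ A) (h : Cyl n → ℝ)
    (hl : ∀ v ∈ A, lap h v ≤ 0) (hb : ∀ v ∉ A, h v ≤ 0) (v : Cyl n) : h v ≤ 0 := by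
  obtain ⟨v₀, hv₀⟩ := hA
  have hle : dirichlet (fun v => max (h v) 0) (fun v => max (h v) 0) ≤ 0 := by
    refine (dirichlet_pos_le h).trans ?_
    rw [← sum_mul_lap]
    refine Finset.sum_nonpos fun w _ => ?_
    by_cases hw : w ∈ A
    · exact mul_nonpos_of_nonneg_of_nonpos (le_max_right _ _) (hl w hw)
    · simp [hb w hw]
  have := eq_zero_of_dirichlet_nonpos _ hle v₀ (by simp [hb v₀ hv₀]) v
  exact (le_max_left _ _).trans this.le

/-- Solvability of the Poisson equation with Dirichlet data outside `A`. -/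
lemma exists_lap_eq (A : Set (Cyl n)) (hA : ∃ v, v ∉ A) (k b : Cyl n → ℝ) :
    ∃ u : Cyl n → ℝ, (∀ v ∈ A, lap u v = k v) ∧ ∀ v ∉ A, u v = b v := by
  classical
  let T : (Cyl n → ℝ) →ₗ[ℝ] (Cyl n → ℝ) :=
    { toFun := fun u v => if v ∈ A then lap u v else u v
      map_add' := fun u w => by ext v; by_cases hv : v ∈ A <;> simp [hv, lap_add]
      map_smul' := fun c u => by ext v; by_cases hv : v ∈ A <;> simp [hv, lap_smul] }
  have hT (u : Cyl n → ℝ) (v : Cyl n) : T u v = if v ∈ A then lap u v else u v := rfl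
  have hinj : Function.Injective T := by
    rw [injective_iff_map_eq_zero]
    intro u hu
    have h1 (v) (hv : v ∈ A) : lap u v = 0 := by simpa [hT, hv] using congrFun hu v
    have h2 (v) (hv : v ∉ A) : u v = 0 := by simpa [hT, hv] using congrFun hu v
    ext v
    refine le_antisymm
      (nonpos_of_lap_nonpos A hA u (fun v hv => (h1 v hv).le) (fun v hv => (h2 v hv).le) v) ?_
    have := nonpos_of_lap_nonpos A hA (fun v => 0 - u v)
      (fun v hv => by rw [lap_const_sub, h1 v hv, neg_zero]) (fun v hv => by simp [h2 v hv]) v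
    simpa using this
  obtain ⟨u, hu⟩ := LinearMap.injective_iff_surjective.1 hinj fun v => if v ∈ A then k v else b v
  refine ⟨u, fun v hv => ?_, fun v hv => ?_⟩
  · simpa [hT, hv] using congrFun hu v
  · simpa [hT, hv] using congrFun hu v

lemma dirichlet_row (f : Cyl n → ℝ) :
    dirichlet f (fun v => (v.row : ℝ)) = ∑ x : ZMod n, (f (Cyl.at x n) - f (Cyl.at x 0)) := by
  have h1 (j : ℕ) : rowForm f (fun v => (v.row : ℝ)) j = 0 := by simp [rowForm, Cyl.at]
  have h2 (x : ZMod n) : colForm f (fun v => (v.row : ℝ)) x = f (Cyl.at x n) - f (Cyl.at x 0) := by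
    rw [← Finset.sum_range_sub (fun j => f (Cyl.at x j)), colForm]
    refine Finset.sum_congr rfl fun j hj => ?_
    have hj : j < n := by simpa using hj
    rw [Cyl.row_at x hj.le, Cyl.row_at x hj]
    push_cast
    ring
  simp [dirichlet, h1, h2]

end

/-! ### The energy inequality and its stability -/

lemma two_mul_sub_le_colForm_add (f : Cyl n → ℝ) (x : ZMod n) {i : ℕ} (hi : i ≤ n) :
    2 * (f (Cyl.at x 0) - f (Cyl.at x i)) ≤ colForm f f x + i := by
  have h1 := Finset.sum_range_sub (fun j => f (Cyl.at x j)) i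
  have h2 : ∑ j ∈ Finset.range i, (f (Cyl.at x (j + 1)) - f (Cyl.at x j)) *
      (f (Cyl.at x (j + 1)) - f (Cyl.at x j)) ≤ colForm f f x :=
    Finset.sum_le_sum_of_subset_of_nonneg (Finset.range_mono hi) fun _ _ _ => mul_self_nonneg _
  have h3 : ∑ j ∈ Finset.range i, -2 * (f (Cyl.at x (j + 1)) - f (Cyl.at x j)) ≤
      ∑ j ∈ Finset.range i, ((f (Cyl.at x (j + 1)) - f (Cyl.at x j)) *
        (f (Cyl.at x (j + 1)) - f (Cyl.at x j)) + 1) :=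
    Finset.sum_le_sum fun j _ => by
      nlinarith [sq_nonneg (f (Cyl.at x (j + 1)) - f (Cyl.at x j) + 1)]
  rw [← Finset.mul_sum, h1, Finset.sum_add_distrib] at h3
  simp at h3
  linarith

lemma two_mul_sub_le_colForm_add' (g : Cyl n → ℝ) (x : ZMod n) {i : ℕ} (hi : i ≤ n) :
    2 * (g (Cyl.at x n) - g (Cyl.at x i)) ≤ colForm g g x + (n - i) := by
  have h1 := Finset.sum_Ico_eq_sub (fun j => g (Cyl.at x (j + 1)) - g (Cyl.at x j)) hi
  rw [Finset.sum_range_sub (fun j => g (Cyl.at x j)),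
    Finset.sum_range_sub (fun j => g (Cyl.at x j))] at h1
  have h2 : ∑ j ∈ Finset.Ico i n, (g (Cyl.at x (j + 1)) - g (Cyl.at x j)) *
      (g (Cyl.at x (j + 1)) - g (Cyl.at x j)) ≤ colForm g g x :=
    Finset.sum_le_sum_of_subset_of_nonneg
      (fun j hj => by simp at hj ⊢; omega) fun _ _ _ => mul_self_nonneg _
  have h3 : ∑ j ∈ Finset.Ico i n, 2 * (g (Cyl.at x (j + 1)) - g (Cyl.at x j)) ≤
      ∑ j ∈ Finset.Ico i n, ((g (Cyl.at x (j + 1)) - g (Cyl.at x j)) *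
        (g (Cyl.at x (j + 1)) - g (Cyl.at x j)) + 1) :=
    Finset.sum_le_sum fun j _ => by
      nlinarith [sq_nonneg (g (Cyl.at x (j + 1)) - g (Cyl.at x j) - 1)]
  rw [← Finset.mul_sum, h1, Finset.sum_add_distrib] at h3
  simp [Nat.cast_sub hi] at h3
  linarith

/-- Two functions on the cylinder with the properties that the proof uses of the potentials of the
two walkers. The function `f` belongs to the blue walker, which moves in the blue set `A`, and `g`
to the red walker, which moves in the complement of `A`. -/
structure IsPotentialPair [NeZero n] (A : Finset (Cyl n)) (f g : Cyl n → ℝ) : Prop where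
  left_eq_zero : ∀ v ∉ A, f v = 0
  right_eq_zero : ∀ v ∈ A, g v = 0
  left_top : ∀ x, f (Cyl.at x n) = 0
  right_bottom : ∀ x, g (Cyl.at x 0) = 0
  left_energy : dirichlet f f ≤ ∑ x : ZMod n, f (Cyl.at x 0)
  right_energy : dirichlet g g ≤ ∑ x : ZMod n, g (Cyl.at x n)

section
variable [NeZero n]

/-- The energy of the horizontal edges of row `j`, for both functions together. -/
noncomputable def rowEnergy (f g : Cyl n → ℝ) (j : ℕ) : ℝ := rowForm f f j + rowForm g g j

/-- The sum of the values at the two ends of the cylinder at which the walkers start. -/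
noncomputable def endSum (f g : Cyl n → ℝ) : ℝ :=
  ∑ x : ZMod n, (f (Cyl.at x 0) + g (Cyl.at x n))

lemma rowEnergy_nonneg (f g : Cyl n → ℝ) (j : ℕ) : 0 ≤ rowEnergy f g j :=
  add_nonneg (rowForm_self_nonneg f j) (rowForm_self_nonneg g j)

variable {A : Finset (Cyl n)} {f g : Cyl n → ℝ}

/-- The basic energy inequality. In column `x` the increments of `f` below row `i x` and those of
`g` above row `k x` are compared with slope one, which is the slope in the optimal state. -/
lemma IsPotentialPair.endSum_add_le (h : IsPotentialPair A f g) {t : ℝ} (i k : ZMod n → ℕ)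
    (hi : ∀ x, i x ≤ n) (hk : ∀ x, k x ≤ n) (hf : ∀ x, f (Cyl.at x (i x)) ≤ t)
    (hg : ∀ x, g (Cyl.at x (k x)) ≤ t) :
    endSum f g + ∑ j ∈ Finset.range (n + 1), rowEnergy f g j ≤
      ∑ x, (4 * t + (i x + (n - k x))) := by
  have key : ∑ x, 2 * (f (Cyl.at x 0) + g (Cyl.at x n)) ≤
      ∑ x, (colForm f f x + colForm g g x + (4 * t + (i x + (n - k x)))) :=
    Finset.sum_le_sum fun x _ => by
      linarith [two_mul_sub_le_colForm_add f x (hi x), two_mul_sub_le_colForm_add' g x (hk x),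
        hf x, hg x]
  have h1 := h.left_energy
  have h2 := h.right_energy
  unfold dirichlet at h1 h2
  rw [← Finset.mul_sum, Finset.sum_add_distrib (g := fun x => 4 * t + _), Finset.sum_add_distrib,
    Finset.sum_add_distrib] at key
  simp only [endSum, rowEnergy, Finset.sum_add_distrib] at *
  linarith

/-- In each column, `f` is followed up to its first zero, and `g` above the row just below that
zero, where `f` is nonzero and hence `g` vanishes. These two parts share at most one edge. -/
lemma IsPotentialPair.sum_rowEnergy_le (h : IsPotentialPair A f g) :
    endSum f g + ∑ j ∈ Finset.range (n + 1), rowEnergy f g j ≤ n * (n + 1) := by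
  classical
  have hex (x : ZMod n) : ∃ j, f (Cyl.at x j) = 0 := ⟨n, h.left_top x⟩
  have hle (x : ZMod n) : Nat.find (hex x) ≤ n := Nat.find_le (h.left_top x)
  have hg0 (x : ZMod n) : g (Cyl.at x (Nat.find (hex x) - 1)) = 0 := by
    rcases Nat.eq_zero_or_pos (Nat.find (hex x)) with h0 | h0
    · rw [h0]; exact h.right_bottom x
    · refine h.right_eq_zero _ ?_
      by_contra hA
      exact Nat.find_min (hex x) (m := Nat.find (hex x) - 1) (by omega) (h.left_eq_zero _ hA)
  refine (h.endSum_add_le (t := 0) (fun x => Nat.find (hex x)) (fun x => Nat.find (hex x) - 1)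
    hle (fun x => by have := hle x; omega) (fun x => (Nat.find_spec (hex x)).le)
    (fun x => (hg0 x).le)).trans ?_
  have : ∀ x ∈ (Finset.univ : Finset (ZMod n)), (4 * (0 : ℝ) + ((Nat.find (hex x) : ℕ) +
      (n - ((Nat.find (hex x) - 1 : ℕ) : ℝ)))) ≤ n + 1 := fun x _ => by
    have : (Nat.find (hex x) : ℝ) ≤ ((Nat.find (hex x) - 1 : ℕ) : ℝ) + 1 := by
      exact_mod_cast (by omega)
    linarith
  refine (Finset.sum_le_sum this).trans (le_of_eq ?_)
  simp [mul_add]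

/-- If a row with little energy contains a red vertex, then `f` is small on that row; if it
contains a blue vertex, then `g` is. So when the values at the two ends are large, no row of the
second kind is far above a row of the first kind. -/
lemma IsPotentialPair.row_sub_row_le (h : IsPotentialPair A f g) {s : ℝ} (hs : 0 ≤ s) {i k : ℕ}
    (hi : i ≤ n) (hk : k ≤ n) (hfi : rowEnergy f g i ≤ s ^ 2 * n)
    (hgk : rowEnergy f g k ≤ s ^ 2 * n) {x y : ZMod n} (hx : Cyl.at x i ∉ A)
    (hy : Cyl.at y k ∈ A) : endSum f g ≤ n * (4 * (s * n) + (i + (n - k))) := by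
  have hn : (0 : ℝ) ≤ n := n.cast_nonneg
  have small (φ : Cyl n → ℝ) (j : ℕ) (x₀ x : ZMod n) (h0 : φ (Cyl.at x₀ j) = 0)
      (hle : rowForm φ φ j ≤ s ^ 2 * n) : φ (Cyl.at x j) ≤ s * n := by
    refine abs_le_of_sq_le_sq' ?_ (by positivity) |>.2
    calc _ ≤ _ := sq_le_rowForm φ j x₀ x h0
      _ ≤ n * (s ^ 2 * n) := by gcongr
      _ = _ := by ring
  have h1 := h.endSum_add_le (fun _ => i) (fun _ => k) (fun _ => hi) (fun _ => hk)
    (fun z => small f i x z (h.left_eq_zero _ hx)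
      (by have := rowForm_self_nonneg g i; unfold rowEnergy at hfi; linarith))
    (fun z => small g k y z (h.right_eq_zero _ hy)
      (by have := rowForm_self_nonneg f k; unfold rowEnergy at hgk; linarith))
  have h2 : 0 ≤ ∑ j ∈ Finset.range (n + 1), rowEnergy f g j :=
    Finset.sum_nonneg fun j _ => rowEnergy_nonneg f g j
  simp at h1
  linarith

end

lemma card_le_of_forall_mem (T : Finset ℕ) {p q : ℝ} (hpq : 0 ≤ q - p + 1)
    (hT : ∀ j ∈ T, p ≤ j ∧ j ≤ q) : (T.card : ℝ) ≤ q - p + 1 := by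
  rcases T.eq_empty_or_nonempty with rfl | hne
  · simpa using hpq
  have hsub : T ⊆ Finset.Icc (T.min' hne) (T.max' hne) := fun j hj =>
    Finset.mem_Icc.2 ⟨T.min'_le j hj, T.le_max' j hj⟩
  have h1 := Finset.card_le_card hsub
  have h2 := T.min'_le_max' hne
  rw [Nat.card_Icc] at h1
  have h3 : (T.card : ℝ) + (T.min' hne : ℕ) ≤ (T.max' hne : ℕ) + 1 := by
    exact_mod_cast (by omega)
  linarith [(hT _ (T.min'_mem hne)).1, (hT _ (T.max'_mem hne)).2]

lemma card_filter_row [NeZero n] (T : Finset ℕ) (hT : T ⊆ Finset.range (n + 1)) :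
    (Finset.univ.filter fun v : Cyl n => (v.row : ℕ) ∈ T).card = n * T.card := by
  rw [Finset.card_filter]
  have := sum_cyl fun v : Cyl n => if (v.row : ℕ) ∈ T then (1 : ℝ) else 0
  have h2 (x : ZMod n) : ∑ j ∈ Finset.range (n + 1),
      (if ((Cyl.at x j).row : ℕ) ∈ T then (1 : ℝ) else 0) = T.card := by
    rw [← Finset.inter_eq_right.2 hT, ← Finset.filter_mem_eq_inter, Finset.card_filter]
    push_cast
    refine Finset.sum_congr rfl fun j hj => ?_
    rw [Cyl.row_at x (by simpa [Nat.lt_succ_iff] using hj)]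
    have : j ≤ n := Nat.lt_succ_iff.1 (Finset.mem_range.1 hj)
    simp [this]
  simp only [h2] at this
  simp at this
  simp
  exact_mod_cast this

/-- Stability of the energy inequality. Few rows have large energy; the others are entirely blue
up to some row, mixed in a short range, and entirely red above it, and counting the blue vertices
shows that this range is near height `α`. -/
lemma IsPotentialPair.mem_goodStates [NeZero n] {A : Finset (Cyl n)} {f g : Cyl n → ℝ}
    (h : IsPotentialPair A f g) {s ε α : ℝ} (hs0 : 0 < s) (hs1 : s ≤ 1) (hε : 16 * s ≤ ε)
    (hα0 : 0 < α) (hα1 : α < 1) (hn : 1 ≤ s ^ 3 * n) (hA : A ∈ stateSpace n α)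
    (hD : (n : ℝ) ^ 2 * (1 - s ^ 3) ≤ endSum f g) : A ∈ goodStates n α ε := by
  classical
  have hn0 : (0 : ℝ) < n := by exact_mod_cast Nat.pos_of_ne_zero (NeZero.ne n)
  -- The rows of large energy. The lower bound on `endSum` leaves at most `s ^ 3 * n ^ 2 + n` of
  -- energy to all rows together, so there are few of them.
  set J := (Finset.range (n + 1)).filter fun j => s ^ 2 * n < rowEnergy f g j with hJ
  have hJcard : (J.card : ℝ) ≤ 2 * s * n := by
    have h1 : (J.card : ℝ) * (s ^ 2 * n) ≤ ∑ j ∈ J, rowEnergy f g j := by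
      rw [← nsmul_eq_mul]
      exact Finset.card_nsmul_le_sum _ _ _ fun j hj => (Finset.mem_filter.1 hj).2.le
    have h2 : ∑ j ∈ J, rowEnergy f g j ≤ ∑ j ∈ Finset.range (n + 1), rowEnergy f g j :=
      Finset.sum_le_sum_of_subset_of_nonneg (Finset.filter_subset _ _)
        fun j _ _ => rowEnergy_nonneg f g j
    have h3 := h.sum_rowEnergy_le
    have h4 : (J.card : ℝ) * (s ^ 2 * n) ≤ 2 * s * n * (s ^ 2 * n) := by nlinarith
    exact le_of_mul_le_mul_right h4 (by positivity)
  set u : ℝ := (J.card : ℝ) with hu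
  set w : ℝ := 4 * (s * n) + s ^ 3 * n with hw
  have hcalm {j : ℕ} (hj : j ≤ n) (hjJ : j ∉ J) : rowEnergy f g j ≤ s ^ 2 * n := by
    simp only [hJ, Finset.mem_filter, Finset.mem_range, not_and, not_lt] at hjJ
    exact hjJ (by omega)
  -- `k` is the lowest row of small energy that contains a red vertex, if there is one.
  obtain ⟨k, hk0, hkred, hkblue⟩ : ∃ k : ℕ, k ≤ n + 1 ∧
      (∀ v : Cyl n, (v.row : ℕ) ∉ J → v ∉ A → k ≤ v.row) ∧
      (∀ v : Cyl n, (v.row : ℕ) ∉ J → v ∈ A → ((v.row : ℕ) : ℝ) ≤ k + w) := by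
    by_cases hex : ∃ k : ℕ, k ∉ J ∧ ∃ v : Cyl n, (v.row : ℕ) = k ∧ v ∉ A
    · refine ⟨Nat.find hex, ?_, fun v hv hvA => Nat.find_le ⟨hv, v, rfl, hvA⟩, fun v hv hvA => ?_⟩
      · obtain ⟨-, v, hv, -⟩ := Nat.find_spec hex
        omega
      · obtain ⟨hkJ, z, hz, hzA⟩ := Nat.find_spec hex
        have := h.row_sub_row_le hs0.le (i := Nat.find hex) (k := v.row) (by omega) (by omega)
          (hcalm (by omega) hkJ) (hcalm (by omega) hv) (x := z.x) (y := v.x)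
          (by rwa [← hz, Cyl.at_row]) (by rwa [Cyl.at_row])
        have h5 : (n : ℝ) * (n * (1 - s ^ 3)) ≤
            n * (4 * (s * n) + ((Nat.find hex : ℕ) + (n - (v.row : ℕ)))) := by
          refine le_trans (le_of_eq ?_) (hD.trans this)
          ring
        have := le_of_mul_le_mul_left h5 hn0
        linarith
    · push Not at hex
      refine ⟨n + 1, le_rfl, fun v hv hvA => absurd (hex _ hv v rfl) (by simpa using hvA),
        fun v _ _ => ?_⟩
      have : ((v.row : ℕ) : ℝ) ≤ n + 1 := by exact_mod_cast v.row.2.le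
      have : 0 ≤ w := by positivity
      push_cast
      linarith
  have hw0 : 0 ≤ w := by positivity
  have hu0 : 0 ≤ u := by positivity
  have hcardA : (A.card : ℝ) ≤ α * (n * (n + 1)) ∧ α * (n * (n + 1)) - 1 < A.card := by
    have hc : Fintype.card (Cyl n) = n * (n + 1) := by
      rw [Fintype.card_congr (Cyl.equivProd n)]; simp
    have hA' : A.card = ⌊α * (n * (n + 1))⌋₊ := by
      have : A.card = _ := hA
      rw [this, hc]; push_cast; rfl
    rw [hA']
    exact ⟨Nat.floor_le (by positivity), Nat.sub_one_lt_floor _⟩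
  -- Counting blue vertices: outside `J`, the rows below `k` are blue and those above `k + w` red.
  have hlow : (k : ℝ) - u ≤ α * (n + 1) := by
    have h1 : (Finset.univ.filter fun v : Cyl n => (v.row : ℕ) ∈ Finset.range k \ J) ⊆ A := by
      intro v hv
      simp only [Finset.mem_filter, Finset.mem_univ, true_and, Finset.mem_sdiff,
        Finset.mem_range] at hv
      by_contra hvA
      exact absurd (hkred v hv.2 hvA) (by omega)
    have h2 := Finset.card_le_card h1
    rw [card_filter_row _ ((Finset.sdiff_subset).trans (Finset.range_mono hk0))] at h2
    have h3 := Finset.le_card_sdiff J (Finset.range k)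
    rw [Finset.card_range] at h3
    have h4 : (k : ℝ) - u ≤ (Finset.range k \ J).card := by
      have : k ≤ (Finset.range k \ J).card + J.card := by omega
      rw [sub_le_iff_le_add, hu]; exact_mod_cast this
    have h5 : (n : ℝ) * (Finset.range k \ J).card ≤ A.card := by exact_mod_cast h2
    refine le_of_mul_le_mul_left ?_ hn0
    nlinarith [hcardA.1]
  have hhigh : α * (n + 1) ≤ k + w + 2 + u := by
    set T := (Finset.range (n + 1)).filter (fun j : ℕ => (j : ℝ) ≤ k + w) ∪ J with hT
    have h1 : A ⊆ Finset.univ.filter fun v : Cyl n => (v.row : ℕ) ∈ T := by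
      intro v hv
      simp only [hT, Finset.mem_filter, Finset.mem_univ, true_and, Finset.mem_union,
        Finset.mem_range]
      by_cases hvJ : (v.row : ℕ) ∈ J
      · exact Or.inr hvJ
      · exact Or.inl ⟨v.row.2, hkblue v hvJ hv⟩
    have h2 := Finset.card_le_card h1
    rw [card_filter_row _ (Finset.union_subset (Finset.filter_subset _ _)
      (Finset.filter_subset _ _))] at h2
    have h3 := card_le_of_forall_mem ((Finset.range (n + 1)).filter fun j : ℕ => (j : ℝ) ≤ k + w)
      (p := 0) (q := k + w) (by rw [sub_zero]; positivity) fun j hj => ⟨by positivity, (Finset.mem_filter.1 hj).2⟩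
    have h4 : (T.card : ℝ) ≤ k + w - 0 + 1 + u := by
      have : (T.card : ℝ) ≤ ((Finset.range (n + 1)).filter fun j : ℕ => (j : ℝ) ≤ k + w).card +
        J.card := by exact_mod_cast Finset.card_union_le _ _
      linarith
    have h5 : (A.card : ℝ) ≤ n * T.card := by exact_mod_cast h2
    have h6 : (1 : ℝ) ≤ n := by exact_mod_cast Nat.pos_of_ne_zero (NeZero.ne n)
    refine le_of_mul_le_mul_left ?_ hn0
    nlinarith [hcardA.2]
  have hsn : s ^ 3 * n ≤ s * n := by
    refine mul_le_mul_of_nonneg_right ?_ hn0.le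
    nlinarith [mul_pos hs0 hs0]
  have hεn : 16 * s * n ≤ ε * n := mul_le_mul_of_nonneg_right hε hn0.le
  have hy (v : Cyl n) : v.y * n = (v.row : ℕ) := by rw [Cyl.y]; field_simp
  -- Both kinds of bad rows are counted alike: outside `J` they lie in a short range.
  have final (R : Set (Fin (n + 1))) (p q : ℝ) (hpq : q - p + 1 ≤ w + u + 4) (hpq' : 0 ≤ q - p + 1)
      (hR : ∀ j ∈ R, (j : ℕ) ∉ J → p ≤ (j : ℕ) ∧ ((j : ℕ) : ℝ) ≤ q) : (R.ncard : ℝ) ≤ ε * n := by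
    set T := ((Finset.univ.filter (· ∈ R)).image fun j : Fin (n + 1) => (j : ℕ)) with hT
    have h1 : R.ncard = T.card := by
      rw [hT, Finset.card_image_of_injective _ Fin.val_injective, ← Set.ncard_coe_finset]
      simp
    have h2 : (T.card : ℝ) ≤ (T \ J).card + J.card := by
      exact_mod_cast Finset.card_le_card_sdiff_add_card
    have h3 := card_le_of_forall_mem (T \ J) hpq' fun j hj => by
      simp only [hT, Finset.mem_sdiff, Finset.mem_image, Finset.mem_filter, Finset.mem_univ,
        true_and] at hj
      obtain ⟨⟨i, hi, rfl⟩, hj⟩ := hj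
      exact hR i hi hj
    rw [h1]
    linarith
  refine ⟨hA, ?_, ?_⟩
  · refine final _ k (max (α * n) (k - 1)) ?_ ?_ ?_
    · rcases max_cases (α * n) ((k : ℝ) - 1) with hm | hm <;> rw [hm.1] <;> linarith
    · linarith [le_max_right (α * n) ((k : ℝ) - 1)]
    · rintro j ⟨v, rfl, hvy, hvA⟩ hj
      refine ⟨by exact_mod_cast hkred v hj hvA, le_max_of_le_left ?_⟩
      rw [← hy v]
      exact mul_le_mul_of_nonneg_right hvy hn0.le
  · refine final _ (min (α * n) (k + w + 1)) (k + w) ?_ ?_ ?_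
    · rcases min_cases (α * n) ((k : ℝ) + w + 1) with hm | hm <;> rw [hm.1] <;> linarith
    · linarith [min_le_right (α * n) ((k : ℝ) + w + 1)]
    · rintro j ⟨v, rfl, hvy, hvA⟩ hj
      refine ⟨min_le_of_left_le ?_, hkblue v hj hvA⟩
      rw [← hy v]
      exact mul_le_mul_of_nonneg_right hvy hn0.le

/-! ### Simple random walk and its first visit to a set -/

lemma firstVisit_eq_iff (x : ℕ → Cyl n) {R : Set (Cyl n)} {w : Cyl n} (hw : w ∈ R) :
    firstVisit x R = w ↔ ∃ i, x i = w ∧ ∀ j < i, x j ∉ R := by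
  unfold firstVisit
  constructor
  · intro h
    refine ⟨_, h, fun j hj hjR => ?_⟩
    exact absurd (Nat.sInf_le (s := {s | x s ∈ R}) hjR) (by omega)
  · rintro ⟨i, rfl, hi⟩
    have : sInf {s | x s ∈ R} = i :=
      le_antisymm (Nat.sInf_le hw) (le_csInf ⟨i, hw⟩ fun j hj => by
        by_contra hlt
        exact hi j (by omega) hj)
    rw [this]

lemma firstVisit_eq_iff_of_notMem (x : ℕ → Cyl n) {R : Set (Cyl n)} {w : Cyl n} (hw : w ∉ R) :
    firstVisit x R = w ↔ x 0 = w ∧ ∀ j, x j ∉ R := by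
  unfold firstVisit
  constructor
  · intro h
    have hno : ∀ j, x j ∉ R := fun j hj => hw (h ▸ Nat.sInf_mem (s := {s | x s ∈ R}) ⟨j, hj⟩)
    have : {s | x s ∈ R} = ∅ := by ext j; simp [hno j]
    rw [this, Nat.sInf_empty] at h
    exact ⟨h, hno⟩
  · rintro ⟨rfl, hno⟩
    have : {s | x s ∈ R} = ∅ := by ext j; simp [hno j]
    rw [this, Nat.sInf_empty]

lemma measurable_firstVisit [NeZero n] (R : Set (Cyl n)) :
    Measurable fun x : ℕ → Cyl n => firstVisit x R := by
  have hm (i : ℕ) (B : Set (Cyl n)) : MeasurableSet {x : ℕ → Cyl n | x i ∈ B} :=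
    measurable_pi_apply i (MeasurableSpace.measurableSet_top (s := B))
  refine measurable_to_countable' fun w => ?_
  by_cases hw : w ∈ R
  · have : (fun x : ℕ → Cyl n => firstVisit x R) ⁻¹' {w} =
        ⋃ i, ({x | x i ∈ ({w} : Set (Cyl n))} ∩ ⋂ j, ⋂ (_ : j < i), {x | x j ∈ Rᶜ}) := by
      ext x
      simp [firstVisit_eq_iff x hw]
    rw [this]
    exact .iUnion fun i => (hm i _).inter (.iInter fun j => .iInter fun _ => hm j _)
  · have : (fun x : ℕ → Cyl n => firstVisit x R) ⁻¹' {w} =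
        {x | x 0 ∈ ({w} : Set (Cyl n))} ∩ ⋂ j, {x | x j ∈ Rᶜ} := by
      ext x
      simp [firstVisit_eq_iff_of_notMem x hw]
    rw [this]
    exact (hm 0 _).inter (.iInter fun j => hm j _)

lemma sum_stepProb_mul [NeZero n] (u : Cyl n → ℝ) (v : Cyl n) :
    ∑ w, stepProb v w * u w = u v - lap u v / 4 := by
  have h1 (w : Cyl n) : stepProb v w * u w = ∑ d, if v.nbr d = w then u w / 4 else 0 := by
    rw [← Finset.sum_filter, Finset.sum_const, nsmul_eq_mul, stepProb]
    ring
  simp_rw [h1]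
  rw [Finset.sum_comm]
  simp [lap, Fin.sum_univ_four]
  ring

section
variable {Ω : Type*} [MeasurableSpace Ω] {P : Measure Ω} {init : Cyl n → ℝ}
  {X : ℕ → Ω → Cyl n}

/-- The probability that the walk is at `v` at time `s` and has not visited `R` before. -/
noncomputable def arrivalProb (P : Measure Ω) (X : ℕ → Ω → Cyl n) (R : Set (Cyl n)) (s : ℕ)
    (v : Cyl n) : ℝ :=
  P.real {ω | X s ω = v ∧ ∀ i < s, X i ω ∉ R}

lemma arrivalProb_nonneg (R : Set (Cyl n)) (s : ℕ) (v : Cyl n) : 0 ≤ arrivalProb P X R s v :=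
  measureReal_nonneg

lemma IsSimpleRandomWalk.arrivalProb_zero (hX : IsSimpleRandomWalk P init X) (R : Set (Cyl n))
    (v : Cyl n) : arrivalProb P X R 0 v = init v := by
  simpa [arrivalProb] using hX.law 0 fun _ => v

/-- The Markov property, for events that determine the present position. -/
lemma IsSimpleRandomWalk.measureReal_step [NeZero n] [IsProbabilityMeasure P]
    (hX : IsSimpleRandomWalk P init X) (s : ℕ) (Q : Set (Fin (s + 1) → Cyl n)) (v w : Cyl n)
    (hQ : ∀ p ∈ Q, p (Fin.last s) = v) :
    P.real {ω | (fun i : Fin (s + 1) => X i ω) ∈ Q ∧ X (s + 1) ω = w} =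
      P.real {ω | (fun i : Fin (s + 1) => X i ω) ∈ Q} * stepProb v w := by
  classical
  have hpath (p : Fin (s + 1) → Cyl n) (hp : p ∈ Q) :
      P.real {ω | (fun i : Fin (s + 1) => X i ω) = p ∧ X (s + 1) ω = w} =
        P.real {ω | (fun i : Fin (s + 1) => X i ω) = p} * stepProb v w := by
    let q : ℕ → Cyl n := fun i => if h : i < s + 1 then p ⟨i, h⟩ else w
    have hq (i : Fin (s + 1)) : q i = p i := dif_pos i.2
    have hqs : q s = v := by rw [← hQ p hp, ← hq]; rfl
    have hqw : q (s + 1) = w := by simp [q]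
    have e1 : {ω | (fun i : Fin (s + 1) => X i ω) = p} = {ω | ∀ i ≤ s, X i ω = q i} := by
      ext ω
      simp only [Set.mem_ofPred_eq, funext_iff, ← hq]
      exact ⟨fun h i hi => h ⟨i, by omega⟩, fun h i => h i (by omega)⟩
    have e2 : {ω | (fun i : Fin (s + 1) => X i ω) = p ∧ X (s + 1) ω = w} =
        {ω | ∀ i ≤ s + 1, X i ω = q i} := by
      ext ω
      simp only [Set.mem_ofPred_eq, funext_iff, ← hq]
      constructor
      · rintro ⟨h, h'⟩ i hi
        rcases Nat.lt_or_ge i (s + 1) with hlt | hge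
        · exact h ⟨i, hlt⟩
        · rw [show i = s + 1 by omega, h', hqw]
      · exact fun h => ⟨fun i => h i (by omega), by rw [h _ le_rfl, hqw]⟩
    rw [e1, e2, hX.law, hX.law, Finset.prod_range_succ, hqs, hqw, mul_assoc]
  have hπ : Measurable fun ω => fun i : Fin (s + 1) => X i ω :=
    measurable_pi_lambda _ fun i => hX.measurable i
  have hπ' : Measurable fun ω => ((fun i : Fin (s + 1) => X i ω), X (s + 1) ω) :=
    hπ.prodMk (hX.measurable _)
  have s1 := sum_measureReal_preimage_singleton (μ := P) Q.toFinset
    (f := fun ω => fun i : Fin (s + 1) => X i ω) fun p _ => hπ (measurableSet_singleton p)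
  have s2 := sum_measureReal_preimage_singleton (μ := P) (Q.toFinset ×ˢ {w})
    (f := fun ω => ((fun i : Fin (s + 1) => X i ω), X (s + 1) ω))
    fun p _ => hπ' (measurableSet_singleton p)
  rw [Finset.sum_product] at s2
  simp only [Finset.sum_singleton] at s2
  have t1 : {ω | (fun i : Fin (s + 1) => X i ω) ∈ Q} =
      (fun ω => fun i : Fin (s + 1) => X i ω) ⁻¹' (Q.toFinset : Set _) := by
    ext ω; simp
  have t2 : {ω | (fun i : Fin (s + 1) => X i ω) ∈ Q ∧ X (s + 1) ω = w} =
      (fun ω => ((fun i : Fin (s + 1) => X i ω), X (s + 1) ω)) ⁻¹'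
        ((Q.toFinset ×ˢ {w} : Finset _) : Set _) := by
    ext ω
    simp [eq_comm (a := w)]
  rw [t1, t2, ← s1, ← s2, Finset.sum_mul]
  refine Finset.sum_congr rfl fun p hp => ?_
  have t3 : (fun ω => fun i : Fin (s + 1) => X i ω) ⁻¹' {p} =
      {ω | (fun i : Fin (s + 1) => X i ω) = p} := by
    ext ω; simp
  have t4 : (fun ω => ((fun i : Fin (s + 1) => X i ω), X (s + 1) ω)) ⁻¹' {(p, w)} =
      {ω | (fun i : Fin (s + 1) => X i ω) = p ∧ X (s + 1) ω = w} := by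
    ext ω; simp
  rw [t3, t4, hpath p (by simpa using hp)]

lemma IsSimpleRandomWalk.arrivalProb_succ [NeZero n] [IsProbabilityMeasure P]
    (hX : IsSimpleRandomWalk P init X) (R : Set (Cyl n)) [DecidablePred (· ∈ R)] (s : ℕ)
    (w : Cyl n) : arrivalProb P X R (s + 1) w =
      ∑ v with v ∉ R, arrivalProb P X R s v * stepProb v w := by
  have hmk (v : Cyl n) (hv : v ∉ R) : arrivalProb P X R s v * stepProb v w =
      P.real {ω | (X s ω = v ∧ ∀ i < s, X i ω ∉ R) ∧ X (s + 1) ω = w} := by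
    have := hX.measureReal_step s
      {p | p (Fin.last s) = v ∧ ∀ i : Fin (s + 1), (i : ℕ) < s → p i ∉ R} v w fun p hp => hp.1
    have e (ω : Ω) : (fun i : Fin (s + 1) => X i ω) ∈
        {p : Fin (s + 1) → Cyl n | p (Fin.last s) = v ∧
          ∀ i : Fin (s + 1), (i : ℕ) < s → p i ∉ R} ↔ (X s ω = v ∧ ∀ i < s, X i ω ∉ R) := by
      simp only [Set.mem_ofPred_eq, Fin.val_last, and_congr_right_iff]
      exact fun _ => ⟨fun h i hi => h ⟨i, by omega⟩ hi, fun h i hi => h i hi⟩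
    simp only [e] at this
    exact this.symm
  have hms (i : ℕ) (B : Set (Cyl n)) : MeasurableSet {ω | X i ω ∈ B} :=
    hX.measurable i (MeasurableSpace.measurableSet_top (s := B))
  rw [Finset.sum_congr rfl fun v hv => hmk v (by simpa using hv),
    ← measureReal_biUnion_finset]
  · unfold arrivalProb
    congr 1
    ext ω
    simp only [Set.mem_ofPred_eq, Set.mem_iUnion, Finset.mem_filter, Finset.mem_univ, true_and,
      exists_prop]
    constructor
    · rintro ⟨h1, h2⟩
      exact ⟨X s ω, h2 s (by omega), ⟨rfl, fun i hi => h2 i (by omega)⟩, h1⟩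
    · rintro ⟨v, hv, ⟨rfl, h2⟩, h1⟩
      refine ⟨h1, fun i hi => ?_⟩
      rcases Nat.lt_succ_iff_lt_or_eq.1 hi with h | rfl
      exacts [h2 i h, hv]
  · intro v _ v' _ hne
    refine Set.disjoint_left.2 fun ω h h' => hne ?_
    rw [← h.1.1, ← h'.1.1]
  · intro v _
    have : {ω | (X s ω = v ∧ ∀ i < s, X i ω ∉ R) ∧ X (s + 1) ω = w} =
        ({ω | X s ω ∈ ({v} : Set _)} ∩ ⋂ i, ⋂ (_ : i < s), {ω | X i ω ∈ Rᶜ}) ∩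
          {ω | X (s + 1) ω ∈ ({w} : Set _)} := by
      ext ω; simp
    rw [this]
    exact ((hms _ _).inter (.iInter fun i => .iInter fun _ => hms _ _)).inter (hms _ _)

lemma IsSimpleRandomWalk.sum_arrivalProb_succ [NeZero n] [IsProbabilityMeasure P]
    (hX : IsSimpleRandomWalk P init X) (R : Set (Cyl n)) [DecidablePred (· ∈ R)] (s : ℕ)
    (u : Cyl n → ℝ) : ∑ w, arrivalProb P X R (s + 1) w * u w =
      ∑ v with v ∉ R, arrivalProb P X R s v * (u v - lap u v / 4) := by
  simp_rw [hX.arrivalProb_succ, Finset.sum_mul]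
  rw [Finset.sum_comm]
  refine Finset.sum_congr rfl fun v _ => ?_
  rw [← sum_stepProb_mul, Finset.mul_sum]
  exact Finset.sum_congr rfl fun w _ => by ring

/-- The walk almost surely visits every nonempty set: the solution `e` of `lap e = 4` off `R` that
vanishes on `R` bounds the expected time of the first visit. -/
lemma IsSimpleRandomWalk.tendsto_sum_arrivalProb [NeZero n] [IsProbabilityMeasure P]
    (hX : IsSimpleRandomWalk P init X) (R : Set (Cyl n)) [DecidablePred (· ∈ R)]
    (hR : R.Nonempty) :
    Filter.Tendsto (fun s => ∑ v with v ∉ R, arrivalProb P X R s v) Filter.atTop (nhds 0) := by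
  obtain ⟨r, hr⟩ := hR
  obtain ⟨e, he, he0⟩ := exists_lap_eq (n := n) Rᶜ ⟨r, by simpa using hr⟩ (fun _ => 4) fun _ => 0
  have hpos (v : Cyl n) : 0 ≤ e v := by
    have := nonpos_of_lap_nonpos Rᶜ ⟨r, by simpa using hr⟩ (fun v => 0 - e v)
      (fun v hv => by rw [lap_const_sub, he v hv]; norm_num) (fun v hv => by simp [he0 v hv]) v
    linarith
  have hstep (s : ℕ) : ∑ w, arrivalProb P X R (s + 1) w * e w =
      ∑ w, arrivalProb P X R s w * e w - ∑ v with v ∉ R, arrivalProb P X R s v := by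
    rw [hX.sum_arrivalProb_succ, ← Finset.sum_filter_add_sum_filter_not Finset.univ (· ∈ R),
      Finset.sum_eq_zero (s := Finset.univ.filter (· ∈ R)) fun w hw => by
        rw [he0 w (by simpa using hw), mul_zero], zero_add, ← Finset.sum_sub_distrib]
    refine Finset.sum_congr rfl fun v hv => ?_
    rw [he v (by simpa using hv)]
    ring
  have hsum (s : ℕ) : ∑ i ∈ Finset.range s, ∑ v with v ∉ R, arrivalProb P X R i v =
      ∑ w, arrivalProb P X R 0 w * e w - ∑ w, arrivalProb P X R s w * e w := by
    induction s with
    | zero => simp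
    | succ s ih => rw [Finset.sum_range_succ, ih, hstep]; ring
  refine (summable_of_sum_range_le (c := ∑ w, arrivalProb P X R 0 w * e w)
    (fun s => Finset.sum_nonneg fun v _ => arrivalProb_nonneg R s v) fun s => ?_).tendsto_atTop_zero
  rw [hsum]
  linarith [Finset.sum_nonneg fun w (_ : w ∈ Finset.univ) =>
    mul_nonneg (arrivalProb_nonneg (P := P) (X := X) R s w) (hpos w)]

lemma IsSimpleRandomWalk.hasSum_arrivalProb [IsProbabilityMeasure P]
    (hX : IsSimpleRandomWalk P init X) {R : Set (Cyl n)} {w : Cyl n} (hw : w ∈ R) :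
    HasSum (fun s => arrivalProb P X R s w) (P.real {ω | firstVisit (fun s => X s ω) R = w}) := by
  have hms (i : ℕ) (B : Set (Cyl n)) : MeasurableSet {ω | X i ω ∈ B} :=
    hX.measurable i (MeasurableSpace.measurableSet_top (s := B))
  have e : {ω | firstVisit (fun s => X s ω) R = w} =
      ⋃ s, {ω | X s ω = w ∧ ∀ i < s, X i ω ∉ R} := by
    ext ω; simp [firstVisit_eq_iff _ hw]
  have hd : Pairwise (Function.onFun Disjoint
      fun s => {ω | X s ω = w ∧ ∀ i < s, X i ω ∉ R}) := by
    refine (symm_disjoint.pairwise_on _).2 fun s t hst => ?_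
    refine Set.disjoint_left.2 fun ω h h' => h'.2 s hst (by rw [h.1]; exact hw)
  have hm (s : ℕ) : MeasurableSet {ω | X s ω = w ∧ ∀ i < s, X i ω ∉ R} := by
    have : {ω | X s ω = w ∧ ∀ i < s, X i ω ∉ R} =
        {ω | X s ω ∈ ({w} : Set _)} ∩ ⋂ i, ⋂ (_ : i < s), {ω | X i ω ∈ Rᶜ} := by
      ext ω; simp
    rw [this]
    exact (hms _ _).inter (.iInter fun i => .iInter fun _ => hms _ _)
  have h1 := measure_iUnion hd hm (μ := P)
  rw [← e] at h1
  unfold arrivalProb Measure.real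
  rw [h1, ENNReal.tsum_toReal_eq fun _ => measure_ne_top _ _]
  exact (ENNReal.summable_toReal (h1 ▸ measure_ne_top _ _)).hasSum

/-- Optional stopping at the first visit to `R`, for a function that is harmonic off `R`. -/
lemma IsSimpleRandomWalk.sum_firstVisit [NeZero n] [IsProbabilityMeasure P]
    (hX : IsSimpleRandomWalk P init X) (R : Set (Cyl n)) [DecidablePred (· ∈ R)]
    (hR : R.Nonempty) (u : Cyl n → ℝ) (hu : ∀ v ∉ R, lap u v = 0) :
    ∑ w with w ∈ R, P.real {ω | firstVisit (fun s => X s ω) R = w} * u w = ∑ v, init v * u v := by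
  have hs : HasSum (fun s => ∑ w with w ∈ R, arrivalProb P X R s w * u w)
      (∑ w with w ∈ R, P.real {ω | firstVisit (fun s => X s ω) R = w} * u w) :=
    hasSum_sum fun w hw => (hX.hasSum_arrivalProb (by simpa using hw)).mul_right _
  have hstep (s : ℕ) : ∑ i ∈ Finset.range s, ∑ w with w ∈ R, arrivalProb P X R i w * u w =
      ∑ v, init v * u v - ∑ w, arrivalProb P X R s w * u w := by
    induction s with
    | zero => simp [hX.arrivalProb_zero]
    | succ s ih =>
      have h1 : ∑ w, arrivalProb P X R (s + 1) w * u w =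
          ∑ v with v ∉ R, arrivalProb P X R s v * u v := by
        rw [hX.sum_arrivalProb_succ]
        refine Finset.sum_congr rfl fun v hv => ?_
        rw [hu v (by simpa using hv), zero_div, sub_zero]
      have h2 := Finset.sum_filter_add_sum_filter_not Finset.univ (· ∈ R)
        fun w => arrivalProb P X R s w * u w
      rw [Finset.sum_range_succ, ih, h1]
      linarith
  -- After the first visit only the part off `R` is left, and it tends to zero.
  have hlim : Filter.Tendsto (fun s => ∑ v with v ∉ R, arrivalProb P X R s v * u v)
      Filter.atTop (nhds 0) := by
    obtain ⟨C, hC⟩ : ∃ C, ∀ v, |u v| ≤ C :=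
      ⟨∑ v, |u v|, fun v => Finset.single_le_sum (fun w _ => abs_nonneg (u w)) (Finset.mem_univ v)⟩
    refine squeeze_zero_norm (a := fun s => (∑ v with v ∉ R, arrivalProb P X R s v) * C)
      (fun s => ?_) (by simpa using (hX.tendsto_sum_arrivalProb R hR).mul_const C)
    rw [Finset.sum_mul, Real.norm_eq_abs]
    refine (Finset.abs_sum_le_sum_abs _ _).trans (Finset.sum_le_sum fun v _ => ?_)
    rw [abs_mul, abs_of_nonneg (arrivalProb_nonneg R s v)]
    exact mul_le_mul_of_nonneg_left (hC v) (arrivalProb_nonneg R s v)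
  have hs' := (Filter.tendsto_add_atTop_iff_nat 1).2 hs.tendsto_sum_nat
  refine tendsto_nhds_unique hs' ?_
  have : (fun s => ∑ i ∈ Finset.range (s + 1), ∑ w with w ∈ R, arrivalProb P X R i w * u w) =
      fun s => ∑ v, init v * u v - ∑ v with v ∉ R, arrivalProb P X R s v * u v := by
    funext s
    rw [hstep, hX.sum_arrivalProb_succ]
    congr 1
    refine Finset.sum_congr rfl fun v hv => ?_
    rw [hu v (by simpa using hv), zero_div, sub_zero]
  rw [this]
  simpa using hlim.const_sub _

end

/-! ### The expected change of height -/

lemma sum_bottomLaw_mul [NeZero n] (u : Cyl n → ℝ) :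
    ∑ v, bottomLaw v * u v = (∑ x : ZMod n, u (Cyl.at x 0)) / n := by
  rw [sum_cyl, Finset.sum_div]
  refine Finset.sum_congr rfl fun x _ => ?_
  rw [Finset.sum_eq_single_of_mem 0 (by simp) fun j hj hj0 => ?_]
  · have : (Cyl.at x 0).row = 0 := by simp [Cyl.at]
    simp [bottomLaw, this]
    ring
  · have : (Cyl.at x j).row ≠ 0 := by
      rw [Ne, Fin.ext_iff, Cyl.row_at x (by simpa [Nat.lt_succ_iff] using hj)]
      simpa using hj0
    simp [bottomLaw, this]

lemma sum_topLaw_mul [NeZero n] (u : Cyl n → ℝ) :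
    ∑ v, topLaw v * u v = (∑ x : ZMod n, u (Cyl.at x n)) / n := by
  rw [sum_cyl, Finset.sum_div]
  refine Finset.sum_congr rfl fun x _ => ?_
  rw [Finset.sum_eq_single_of_mem n (by simp) fun j hj hj0 => ?_]
  · have : (Cyl.at x n).row = Fin.last n := by simp [Cyl.at, Fin.ext_iff]
    simp [topLaw, this]
    ring
  · have : (Cyl.at x j).row ≠ Fin.last n := by
      rw [Ne, Fin.ext_iff, Cyl.row_at x (by simpa [Nat.lt_succ_iff] using hj)]
      simpa using hj0
    simp [topLaw, this]

/-- The potentials of the two walkers, made from the harmonic extensions of the row index. Here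
`u v` is the expected row in which the blue walker started at `v` first meets a red vertex, and
`w v` the expected row in which the red walker started at `v` first meets a vertex of `B`. -/
lemma isPotentialPair_of_harmonic [NeZero n] {A B : Finset (Cyl n)} (hAB : A ⊆ B)
    (hA : ∃ v, v ∉ A) (hB : B.Nonempty) {u w : Cyl n → ℝ} (hu : ∀ v ∈ A, lap u v = 0)
    (hu' : ∀ v ∉ A, u v = (v.row : ℕ)) (hw : ∀ v ∉ B, lap w v = 0)
    (hw' : ∀ v ∈ B, w v = (v.row : ℕ)) :
    IsPotentialPair A (fun v => max (u v - (v.row : ℕ)) 0) (fun v => max ((v.row : ℕ) - w v) 0) ∧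
      endSum (fun v => max (u v - (v.row : ℕ)) 0) (fun v => max ((v.row : ℕ) - w v) 0) =
        ∑ x : ZMod n, u (Cyl.at x 0) + ∑ x : ZMod n, (n - w (Cyl.at x n)) := by
  obtain ⟨b, hb⟩ := hB
  have hBc : ∃ v, v ∉ ((B : Set (Cyl n))ᶜ) := ⟨b, by simpa using hb⟩
  have hrow (v : Cyl n) : ((v.row : ℕ) : ℝ) ≤ n := by
    exact_mod_cast Nat.lt_succ_iff.1 v.row.2
  have hu0 (v : Cyl n) : 0 ≤ u v := by
    have := nonpos_of_lap_nonpos (A : Set (Cyl n)) (by simpa using hA) (fun v => 0 - u v)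
      (fun v hv => by rw [lap_const_sub, hu v (by simpa using hv), neg_zero])
      (fun v hv => by simp [hu' v (by simpa using hv)]) v
    linarith
  have hun (v : Cyl n) : u v ≤ n := by
    have := nonpos_of_lap_nonpos (A : Set (Cyl n)) (by simpa using hA) (fun v => u v - n)
      (fun v hv => by rw [lap_sub_const, hu v (by simpa using hv)])
      (fun v hv => by linarith [hu' v (by simpa using hv), hrow v]) v
    linarith
  have hw0 (v : Cyl n) : 0 ≤ w v := by
    have := nonpos_of_lap_nonpos _ hBc (fun v => 0 - w v)
      (fun v hv => by rw [lap_const_sub, hw v (by simpa using hv), neg_zero])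
      (fun v hv => by simp [hw' v (by simpa using hv)]) v
    linarith
  have hwn (v : Cyl n) : w v ≤ n := by
    have := nonpos_of_lap_nonpos _ hBc (fun v => w v - n)
      (fun v hv => by rw [lap_sub_const, hw v (by simpa using hv)])
      (fun v hv => by linarith [hw' v (by simpa using hv), hrow v]) v
    linarith
  have r0 (x : ZMod n) : (((Cyl.at x 0).row : ℕ) : ℝ) = 0 := by rw [Cyl.row_at x n.zero_le]; simp
  have rn (x : ZMod n) : (((Cyl.at x n).row : ℕ) : ℝ) = n := by rw [Cyl.row_at x le_rfl]
  have f0 (v : Cyl n) (hv : v ∉ A) : max (u v - (v.row : ℕ)) 0 = 0 := by simp [hu' v hv]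
  have g0 (v : Cyl n) (hv : v ∈ B) : max ((v.row : ℕ) - w v) 0 = 0 := by simp [hw' v hv]
  have fn (x : ZMod n) : max (u (Cyl.at x n) - ((Cyl.at x n).row : ℕ)) 0 = 0 := by
    rw [rn]; exact max_eq_right (by linarith [hun (Cyl.at x n)])
  have gb (x : ZMod n) : max (((Cyl.at x 0).row : ℕ) - w (Cyl.at x 0)) 0 = 0 := by
    rw [r0]; exact max_eq_right (by linarith [hw0 (Cyl.at x 0)])
  refine ⟨⟨f0, fun v hv => g0 v (hAB hv), fn, gb, ?_, ?_⟩, ?_⟩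
  · refine (dirichlet_pos_le fun v => u v - (v.row : ℕ)).trans (le_of_eq ?_)
    have e : ∀ v, max (u v - (v.row : ℕ)) 0 * lap (fun v => u v - (v.row : ℕ)) v =
        -(max (u v - (v.row : ℕ)) 0 * lap (fun v => ((v.row : ℕ) : ℝ)) v) := fun v => by
      by_cases hv : v ∈ A
      · have : lap (fun v => u v - (v.row : ℕ)) v = lap u v - lap (fun v => ((v.row : ℕ) : ℝ)) v :=
          lap_sub _ _ v
        rw [this, hu v hv]
        ring
      · rw [f0 v hv]; simp
    rw [← sum_mul_lap, Finset.sum_congr rfl fun v _ => e v, Finset.sum_neg_distrib, sum_mul_lap,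
      dirichlet_row, ← Finset.sum_neg_distrib]
    exact Finset.sum_congr rfl fun x _ => by rw [fn]; ring
  · refine (dirichlet_pos_le fun v => (v.row : ℕ) - w v).trans (le_of_eq ?_)
    have e : ∀ v, max ((v.row : ℕ) - w v) 0 * lap (fun v => (v.row : ℕ) - w v) v =
        max ((v.row : ℕ) - w v) 0 * lap (fun v => ((v.row : ℕ) : ℝ)) v := fun v => by
      by_cases hv : v ∈ B
      · rw [g0 v hv]; simp
      · have : lap (fun v => (v.row : ℕ) - w v) v = lap (fun v => ((v.row : ℕ) : ℝ)) v - lap w v :=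
          lap_sub _ _ v
        rw [this, hw v hv, sub_zero]
    rw [← sum_mul_lap, Finset.sum_congr rfl fun v _ => e v, sum_mul_lap, dirichlet_row]
    exact Finset.sum_congr rfl fun x _ => by rw [gb]; ring
  · rw [endSum, ← Finset.sum_add_distrib]
    refine Finset.sum_congr rfl fun x _ => ?_
    rw [r0, rn, max_eq_left (by linarith [hu0 (Cyl.at x 0)]),
      max_eq_left (by linarith [hwn (Cyl.at x n)]), sub_zero]

lemma height_erase_insert {S : Finset (Cyl n)} {z w : Cyl n} (hz : z ∉ S) (hw : w ∈ insert z S) :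
    height ((insert z S).erase w) - height S = w.y - z.y := by
  unfold height
  have h1 := Finset.sum_erase_add (f := fun v : Cyl n => 1 - v.y) _ hw
  rw [Finset.sum_insert hz] at h1
  linarith

/-- The expectation of a function of `Z` and `W Z`, where `Z` is independent of each `W z`. -/
lemma integral_comp_of_indepFun {Ω β : Type*} [MeasurableSpace Ω] {P : Measure Ω}
    [IsProbabilityMeasure P] [Fintype β] [MeasurableSpace β] [MeasurableSingletonClass β]
    {Z : Ω → β} {W : β → Ω → β} (hZ : Measurable Z) (hW : ∀ z, Measurable (W z))
    (hind : ∀ z, IndepFun Z (W z) P) (F : β → β → ℝ) :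
    ∫ ω, F (Z ω) (W (Z ω) ω) ∂P =
      ∑ z, P.real {ω | Z ω = z} * ∑ w, P.real {ω | W z ω = w} * F z w := by
  have hWW : Measurable fun p : β × Ω => W p.1 p.2 := measurable_from_prod_countable_right hW
  have hV : Measurable fun ω => (Z ω, W (Z ω) ω) :=
    hZ.prodMk (hWW.comp (hZ.prodMk measurable_id))
  have : IsProbabilityMeasure (P.map fun ω => (Z ω, W (Z ω) ω)) :=
    Measure.isProbabilityMeasure_map hV.aemeasurable
  have hint : ∫ ω, F (Z ω) (W (Z ω) ω) ∂P =
      ∫ p, F p.1 p.2 ∂(P.map fun ω => (Z ω, W (Z ω) ω)) :=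
    (integral_map (f := fun p : β × β => F p.1 p.2) hV.aemeasurable
      (measurable_of_countable _).aestronglyMeasurable).symm
  rw [hint, integral_fintype .of_finite, Fintype.sum_prod_type]
  refine Finset.sum_congr rfl fun z _ => ?_
  rw [Finset.mul_sum]
  refine Finset.sum_congr rfl fun w _ => ?_
  rw [smul_eq_mul, ← mul_assoc]
  congr 1
  rw [map_measureReal_apply hV (measurableSet_singleton _)]
  have e : (fun ω => (Z ω, W (Z ω) ω)) ⁻¹' {(z, w)} = Z ⁻¹' {z} ∩ W z ⁻¹' {w} := by
    ext ω
    simp only [Set.mem_preimage, Set.mem_singleton_iff, Prod.mk.injEq, Set.mem_inter_iff]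
    exact ⟨fun h => ⟨h.1, h.1 ▸ h.2⟩, fun h => ⟨h.1, h.1.symm ▸ h.2⟩⟩
  rw [e, measureReal_def, (hind z).measure_inter_preimage_eq_mul _ _ (measurableSet_singleton _)
    (measurableSet_singleton _), ENNReal.toReal_mul]
  rfl

/-- The expected change of height, as a sum over the positions of the two recoloured vertices. -/
lemma integral_height_sub [NeZero n] {Ω : Type*} [MeasurableSpace Ω] {P : Measure Ω}
    [IsProbabilityMeasure P] {X Y : ℕ → Ω → Cyl n} (hX : IsSimpleRandomWalk P bottomLaw X)
    (hY : IsSimpleRandomWalk P topLaw Y)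
    (hXY : IndepFun (fun ω s => X s ω) (fun ω s => Y s ω) P) (S : Finset (Cyl n)) :
    ∫ ω, (height (fullStep S (fun s => X s ω) (fun s => Y s ω)) - height S) ∂P =
      ∑ z, P.real {ω | firstVisit (fun s => X s ω) {v | v ∉ S} = z} *
        ∑ w, P.real {ω | firstVisit (fun s => Y s ω) {v | v ∈ insert z S} = w} *
          (height ((insert z S).erase w) - height S) :=
  integral_comp_of_indepFun
    ((measurable_firstVisit {v | v ∉ S}).comp (measurable_pi_lambda _ hX.measurable))
    (fun z => (measurable_firstVisit {v | v ∈ insert z S}).comp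
      (measurable_pi_lambda _ hY.measurable))
    (fun z => hXY.comp (measurable_firstVisit {v | v ∉ S})
      (measurable_firstVisit {v | v ∈ insert z S}))
    fun z w => height ((insert z S).erase w) - height S

lemma exists_notMem_of_mem_stateSpace [NeZero n] {α : ℝ} (hα0 : 0 < α) (hα1 : α < 1)
    {S : Finset (Cyl n)} (hS : S ∈ stateSpace n α) : ∃ v, v ∉ S := by
  by_contra! hall
  have h1 : S.card = ⌊α * Fintype.card (Cyl n)⌋₊ := hS
  rw [Finset.eq_univ_of_forall hall, Finset.card_univ] at h1
  have hpos : (0 : ℝ) < Fintype.card (Cyl n) := by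
    exact_mod_cast Fintype.card_pos_iff.2 ⟨(⟨0, 0⟩ : Cyl n)⟩
  have h2 := Nat.floor_le (mul_nonneg hα0.le hpos.le)
  rw [← h1] at h2
  nlinarith

/-- The first-visit law of the walk is carried by the target set. -/
lemma IsSimpleRandomWalk.measureReal_firstVisit_eq_zero [NeZero n] {Ω : Type*}
    [MeasurableSpace Ω] {P : Measure Ω} [IsProbabilityMeasure P] {init : Cyl n → ℝ}
    {X : ℕ → Ω → Cyl n} (hX : IsSimpleRandomWalk P init X) (R : Set (Cyl n))
    (hR : R.Nonempty) {v : Cyl n} (hv : v ∉ R) :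
    P.real {ω | firstVisit (fun s => X s ω) R = v} = 0 := by
  classical
  have hm : Measurable fun ω => firstVisit (fun s => X s ω) R :=
    (measurable_firstVisit R).comp (measurable_pi_lambda _ hX.measurable)
  have h1 := hX.sum_firstVisit R hR (fun _ => 1) fun v _ => by simp [lap]
  have h0 := hX.sum_firstVisit Set.univ ⟨v, trivial⟩ (fun _ => 1) fun v _ => by simp [lap]
  have tot (T : Finset (Cyl n)) := sum_measureReal_preimage_singleton (μ := P) T
    (f := fun ω => firstVisit (fun s => X s ω) R) fun w _ => hm (measurableSet_singleton w)
  have tot' := sum_measureReal_preimage_singleton (μ := P) Finset.univ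
    (f := fun ω => firstVisit (fun s => X s ω) Set.univ) fun w _ =>
      ((measurable_firstVisit Set.univ).comp (measurable_pi_lambda _ hX.measurable))
        (measurableSet_singleton w)
  have hfull : ∑ w with w ∈ R, P.real {ω | firstVisit (fun s => X s ω) R = w} = 1 := by
    have : ∑ w, P.real {ω | firstVisit (fun s => X s ω) Set.univ = w} = 1 := by
      refine tot'.trans ?_
      simp
    simp only [mul_one, Set.mem_univ, Finset.filter_true] at h1 h0
    rw [h1, ← h0, this]
  have hle : ∑ w ∈ insert v (Finset.univ.filter (· ∈ R)),
      P.real {ω | firstVisit (fun s => X s ω) R = w} ≤ 1 :=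
    (tot (insert v (Finset.univ.filter (· ∈ R)))).le.trans measureReal_le_one
  rw [Finset.sum_insert (by simpa using hv), hfull] at hle
  exact le_antisymm (by linarith) measureReal_nonneg

/-- Outside `goodStates` the expected change of height is at least `s ^ 3`: for every vertex `z`
that the blue walker may recolour, `IsPotentialPair.mem_goodStates` bounds `endSum`, and the drift
is the average over `z` of `1 - endSum / n ^ 2`. -/
lemma le_integral_height_sub [NeZero n] {ε s α : ℝ} (hs0 : 0 < s) (hs1 : s ≤ 1)
    (hε : 16 * s ≤ ε) (hα0 : 0 < α) (hα1 : α < 1) (hn : 1 ≤ s ^ 3 * n) {S : Finset (Cyl n)}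
    (hS : S ∈ stateSpace n α) (hSg : S ∉ goodStates n α ε)
    {Ω : Type*} [MeasurableSpace Ω] {P : Measure Ω}
    [IsProbabilityMeasure P] {X Y : ℕ → Ω → Cyl n} (hX : IsSimpleRandomWalk P bottomLaw X)
    (hY : IsSimpleRandomWalk P topLaw Y)
    (hXY : IndepFun (fun ω s => X s ω) (fun ω s => Y s ω) P) :
    s ^ 3 ≤ ∫ ω, (height (fullStep S (fun s => X s ω) (fun s => Y s ω)) - height S) ∂P := by
  classical
  have hn0 : (0 : ℝ) < n := by exact_mod_cast Nat.pos_of_ne_zero (NeZero.ne n)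
  have hSc := exists_notMem_of_mem_stateSpace hα0 hα1 hS
  obtain ⟨u, hu, hu'⟩ := exists_lap_eq (n := n) (S : Set (Cyl n)) (by simpa using hSc)
    (fun _ => 0) fun v => (v.row : ℕ)
  set p : Cyl n → ℝ := fun z => P.real {ω | firstVisit (fun s => X s ω) {v | v ∉ S} = z} with hp
  have hR : {v | v ∉ S}.Nonempty := hSc
  have hp0 (z : Cyl n) (hz : z ∈ S) : p z = 0 :=
    hX.measureReal_firstVisit_eq_zero _ hR (by simpa using hz)
  have hblue := hX.sum_firstVisit {v | v ∉ S} hR u fun v hv => hu v (by simpa using hv)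
  rw [sum_bottomLaw_mul] at hblue
  set D : ℝ := ∑ x : ZMod n, u (Cyl.at x 0) with hD
  have hp1 : ∑ z with z ∈ {v | v ∉ S}, p z = 1 := by
    have := hX.sum_firstVisit {v | v ∉ S} hR (fun _ => 1) fun v _ => by simp [lap]
    rw [sum_bottomLaw_mul] at this
    simpa [hn0.ne'] using this
  rw [integral_height_sub hX hY hXY, ← Finset.sum_filter_add_sum_filter_not Finset.univ
    (· ∈ {v | v ∉ S})]
  rw [Finset.sum_eq_zero (s := Finset.univ.filter (¬ · ∈ {v | v ∉ S})) fun z hz => by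
    rw [show P.real {ω | firstVisit (fun s => X s ω) {v | v ∉ S} = z} = 0 from
      hp0 z (by simpa using hz), zero_mul], add_zero]
  -- The mean height at which the red walker stops, given the vertex `z` of the blue walker.
  have hred (z : Cyl n) (hz : z ∈ {v | v ∉ S}) : s ^ 3 + D / n ^ 2 - u z / n ≤
      ∑ w, P.real {ω | firstVisit (fun s => Y s ω) {v | v ∈ insert z S} = w} *
          (height ((insert z S).erase w) - height S) := by
    have hzS : z ∉ S := hz
    have hB : {v | v ∈ insert z S}.Nonempty := ⟨z, by simp⟩
    obtain ⟨w, hw, hw'⟩ := exists_lap_eq (n := n) {v | v ∉ insert z S} ⟨z, by simp⟩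
      (fun _ => 0) fun v => (v.row : ℕ)
    obtain ⟨hpair, hend⟩ := isPotentialPair_of_harmonic (A := S) (B := insert z S)
      (Finset.subset_insert z S) hSc ⟨z, by simp⟩ (fun v hv => hu v (by simpa using hv))
      (fun v hv => hu' v (by simpa using hv)) (fun v hv => hw v hv)
      (fun v hv => hw' v (not_not.2 hv))
    have hlt := lt_of_not_ge fun hge =>
      hSg (hpair.mem_goodStates hs0 hs1 hε hα0 hα1 hn hS hge)
    have h1 := hY.sum_firstVisit {v | v ∈ insert z S} hB w fun v hv => hw v hv
    have h2 := hY.sum_firstVisit {v | v ∈ insert z S} hB (fun _ => 1) fun v _ => by simp [lap]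
    rw [sum_topLaw_mul] at h1 h2
    rw [hend, Finset.sum_sub_distrib] at hlt
    set D' : ℝ := ∑ x : ZMod n, w (Cyl.at x n) with hD'
    rw [← Finset.sum_filter_add_sum_filter_not Finset.univ (· ∈ {v | v ∈ insert z S}),
      Finset.sum_eq_zero (s := Finset.univ.filter (¬ · ∈ {v | v ∈ insert z S})) fun v hv => by
        rw [hY.measureReal_firstVisit_eq_zero _ hB (by simpa using hv), zero_mul], add_zero]
    have e : ∑ v with v ∈ {v | v ∈ insert z S},
        P.real {ω | firstVisit (fun s => Y s ω) {v | v ∈ insert z S} = v} *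
          (height ((insert z S).erase v) - height S) = D' / n / n - u z / n := by
      have e1 : ∀ v ∈ Finset.univ.filter (· ∈ {v | v ∈ insert z S}),
          P.real {ω | firstVisit (fun s => Y s ω) {v | v ∈ insert z S} = v} *
            (height ((insert z S).erase v) - height S) =
          P.real {ω | firstVisit (fun s => Y s ω) {v | v ∈ insert z S} = v} * w v / n -
          P.real {ω | firstVisit (fun s => Y s ω) {v | v ∈ insert z S} = v} * 1 * (u z / n) := by
        intro v hv
        have hv : v ∈ insert z S := by simpa using hv
        rw [height_erase_insert hzS hv, hw' v (not_not.2 hv), hu' z (by simpa using hzS),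
          Cyl.y, Cyl.y]
        ring
      rw [Finset.sum_congr rfl e1, Finset.sum_sub_distrib, ← Finset.sum_div, ← Finset.sum_mul, h1,
        h2]
      simp [hn0.ne']
    rw [e]
    have hD2 : D / n ^ 2 + s ^ 3 ≤ D' / n ^ 2 := by
      rw [← le_sub_iff_add_le, ← sub_nonneg]
      have : 0 ≤ (D' - s ^ 3 * n ^ 2 - D) / n ^ 2 := by
        refine div_nonneg ?_ (by positivity)
        simp at hlt
        linarith
      refine this.trans (le_of_eq ?_)
      field_simp
    have : D' / n / n = D' / n ^ 2 := by rw [div_div, sq]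
    linarith
  calc s ^ 3 = ∑ z with z ∈ {v | v ∉ S}, p z * (s ^ 3 + D / n ^ 2 - u z / n) := by
        have e (z : Cyl n) : p z * (s ^ 3 + D / n ^ 2 - u z / n) =
            p z * (s ^ 3 + D / n ^ 2) - p z * u z / n := by ring
        simp only [e]
        rw [Finset.sum_sub_distrib, ← Finset.sum_mul, hp1, ← Finset.sum_div, hblue, div_div, sq]
        ring
    _ ≤ _ := Finset.sum_le_sum fun z hz =>
        mul_le_mul_of_nonneg_left (hred z (by simpa using hz)) measureReal_nonneg

end CompetitiveErosion

theorem theorem5 (ε : ℝ) (hε : 0 < ε) :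
    ∃ a : ℝ, 0 < a ∧ ∀ α : ℝ, 0 < α → α < 1 →
      ∃ N : ℕ, ∀ (n : ℕ) [NeZero n], N ≤ n →
        ∀ σ ∈ stateSpace n α \ goodStates n α ε,
          ∀ (Ω : Type*) [MeasurableSpace Ω] (P : Measure Ω) [IsProbabilityMeasure P]
            (X Y : ℕ → Ω → Cyl n),
            IsSimpleRandomWalk P bottomLaw X → IsSimpleRandomWalk P topLaw Y →
            IndepFun (fun ω s => X s ω) (fun ω s => Y s ω) P →
              a ≤ ∫ ω, (height (fullStep σ (fun s => X s ω) (fun s => Y s ω)) - height σ) ∂P := by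
  set s : ℝ := min ε 1 / 16 with hs
  have hs0 : 0 < s := div_pos (lt_min hε one_pos) (by norm_num)
  have hs1 : s ≤ 1 := by linarith [min_le_right ε 1]
  have hsε : 16 * s ≤ ε := by linarith [min_le_left ε 1]
  have ha : 0 < s ^ 3 := by positivity
  refine ⟨s ^ 3, ha, fun α hα0 hα1 => ⟨⌈1 / s ^ 3⌉₊, fun n _ hN σ hσ Ω _ P _ X Y hX hY hXY => ?_⟩⟩
  refine le_integral_height_sub hs0 hs1 hsε hα0 hα1 ?_ hσ.1 hσ.2 hX hY hXY
  have : 1 / s ^ 3 ≤ n := (Nat.le_ceil _).trans (by exact_mod_cast hN)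
  rwa [div_le_iff₀' ha] at this
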